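/- All graphs are undirected and simple. A \emph{hole} is an induced cycle of length at least $4$. Consider the following graphs. \begin{itemize} \item The \emph{long claw}: the $7$-vertex tree obtained from the claw $K_{1,3}$ by subdividing each edge once. \item The \emph{whipping top}: a path $v_1v_2v_3v_4v_5$, a vertex adjacent to all of $v_1,\dots,v_5$, and a vertex adjacent only to $v_3$. \item The \emph{$\dagger$-AW with $d$ base vertices} ($d\ge 2$): vertices $s,c,b_0,\dots,b_{d+1}$ and edges $sc$, $b_ib_{i+1}$ for $0\le i\le d$, and $cb_i$ for $1\le i\le d$. \item The \emph{$\ddagger$-AW with $d$ base vertices} ($d\ge 1$): vertices $s,c_1,c_2,b_0,\dots,b_{d+1}$ and edges $sc_1$, $sc_2$, $c_1c_2$, $b_ib_{i+1}$ for $0\le i\le d$, $c_1b_i$ for $0\le i\le d$, and $c_2b_i$ for $1\le i\le d+1$. \end{itemize} The long claw, the whipping top, and the $\dagger$- and $\ddagger$-AWs with $d\le 3$ are the \emph{small} asteroidal witnesses; the $\dagger$- and $\ddagger$-AWs with $d>3$ are the \emph{long} ones, and the vertex $s$ of a long one is its \emph{shallow terminal}. A graph is \emph{reduced} if it contains no hole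 and no small asteroidal witness as an induced subgraph. For a reduced graph $G$, let $ST(G)$ be the set of shallow terminals of all long asteroidal witnesses that are induced subgraphs of $G$. A vertex set $M$ is a \emph{module} of $G$ if all vertices of $M$ have the same neighbors outside $M$; it is a \emph{simplicial module} if it is a module, $G[M]$ is connected, and the set $N(M)$ of vertices outside $M$ with a neighbor in $M$ is a clique. \textbf{Theorem.} Let $G$ be a reduced graph. The vertex set of every connected component of $G[ST(G)]$ is a simplicial module of $G$. -/

import Mathlib

open scoped SimpleGraph

namespace IntervalCompletion

/-- The long claw: the claw with center `0` and leaves `1, 2, 3`, each of whose edges is subdivided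
once more outwards, giving the terminals `4, 5, 6`. -/
def longClaw : SimpleGraph (Fin 7) :=
  SimpleGraph.fromEdgeSet {s(0, 1), s(0, 2), s(0, 3), s(1, 4), s(2, 5), s(3, 6)}

/-- The whipping top: an induced path `0 1 2 3 4`, a vertex `5` adjacent to all of the path, and a
vertex `6` adjacent only to the middle vertex `2` of the path. -/
def whippingTop : SimpleGraph (Fin 7) :=
  SimpleGraph.fromEdgeSet {s(0, 1), s(1, 2), s(2, 3), s(3, 4),
    s(5, 0), s(5, 1), s(5, 2), s(5, 3), s(5, 4), s(6, 2)}

/-- Vertices of the †-graph: the shallow terminal `s`, the center `c`, and the path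
`b 0, b 1, ..., b (d + 1)`, whose ends are the base terminals and whose inner vertices
`b 1, ..., b d` are the base. -/
inductive DagVertex (d : ℕ) : Type
  | s : DagVertex d
  | c : DagVertex d
  | b : Fin (d + 2) → DagVertex d

/-- Edges of the †-graph, each listed in one direction. -/
def DagVertex.rel {d : ℕ} : DagVertex d → DagVertex d → Prop
  | .s, .c => True
  | .c, .b i => 1 ≤ i.val ∧ i.val ≤ d
  | .b i, .b j => i.val + 1 = j.val
  | _, _ => False

/-- The †-graph with `d` base vertices; for `d ≥ 2` it is the †-asteroidal witness. -/
def dagGraph (d : ℕ) : SimpleGraph (DagVertex d) :=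
  SimpleGraph.fromRel DagVertex.rel

/-- Vertices of the ‡-graph: the shallow terminal `s`, the centers `c₁, c₂`, and the path
`b 0, b 1, ..., b (d + 1)`, whose ends are the base terminals and whose inner vertices
`b 1, ..., b d` are the base. -/
inductive DDagVertex (d : ℕ) : Type
  | s : DDagVertex d
  | c₁ : DDagVertex d
  | c₂ : DDagVertex d
  | b : Fin (d + 2) → DDagVertex d

/-- Edges of the ‡-graph, each listed in one direction: besides the base, `c₁` sees the left base
terminal `b 0` and `c₂` the right one `b (d + 1)`. -/
def DDagVertex.rel {d : ℕ} : DDagVertex d → DDagVertex d → Prop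
  | .s, .c₁ => True
  | .s, .c₂ => True
  | .c₁, .c₂ => True
  | .c₁, .b i => i.val ≤ d
  | .c₂, .b i => 1 ≤ i.val
  | .b i, .b j => i.val + 1 = j.val
  | _, _ => False

/-- The ‡-graph with `d` base vertices; for `d ≥ 1` it is the ‡-asteroidal witness. -/
def ddagGraph (d : ℕ) : SimpleGraph (DDagVertex d) :=
  SimpleGraph.fromRel DDagVertex.rel

variable {V : Type*}

/-- `G` has a hole: an induced cycle of length at least 4. -/
def HasHole (G : SimpleGraph V) : Prop :=
  ∃ n : ℕ, 4 ≤ n ∧ SimpleGraph.cycleGraph n ⊴ G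

/-- `G` has a small asteroidal witness as an induced subgraph: a long claw, a whipping top, or a
†- or ‡-asteroidal witness with at most 3 base vertices. -/
def HasSmallAW (G : SimpleGraph V) : Prop :=
  longClaw ⊴ G ∨ whippingTop ⊴ G ∨
    (∃ d : ℕ, 2 ≤ d ∧ d ≤ 3 ∧ dagGraph d ⊴ G) ∨
    (∃ d : ℕ, 1 ≤ d ∧ d ≤ 3 ∧ ddagGraph d ⊴ G)

/-- `G` is reduced: no hole and no small asteroidal witness. -/
def IsReduced (G : SimpleGraph V) : Prop :=
  ¬ HasHole G ∧ ¬ HasSmallAW G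

/-- `ST(G)`: the shallow terminals of the long asteroidal witnesses of `G`, that is, of the induced
†- and ‡-subgraphs with more than 3 base vertices. -/
def shallowTerminals (G : SimpleGraph V) : Set V :=
  {v | ∃ d : ℕ, 3 < d ∧
    ((∃ f : dagGraph d ↪g G, f DagVertex.s = v) ∨
      (∃ f : ddagGraph d ↪g G, f DDagVertex.s = v))}

/-- The neighborhood `N(M)` of a vertex set: vertices outside `M` with a neighbor in `M`. -/
def nbhd (G : SimpleGraph V) (M : Set V) : Set V :=
  {x | x ∉ M ∧ ∃ u ∈ M, G.Adj u x}

/-- `M` is a module: all its vertices have the same neighbors outside `M`. -/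
def IsModule (G : SimpleGraph V) (M : Set V) : Prop :=
  ∀ u ∈ M, ∀ v ∈ M, ∀ x ∉ M, (G.Adj u x ↔ G.Adj v x)

/-- `M` is a simplicial module: a module inducing a connected subgraph, with `N(M)` a clique. -/
def IsSimplicialModule (G : SimpleGraph V) (M : Set V) : Prop :=
  IsModule G M ∧ (G.induce M).Connected ∧ G.IsClique (nbhd G M)

end IntervalCompletion

/-!
Fix `s ∈ ST(G)` and a long witness of least base among those with shallow terminal `s`. Let `A` be
the component of `s` in the subgraph of all vertices without neighbors in the base. Replacing the
shallow terminal by an adjacent vertex without neighbors in the base gives again a witness, since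
otherwise a small witness or a hole appears; hence every vertex of `A` is a shallow terminal of the
same witness. A vertex of `N(A)` sees some base vertex, hence all of them, since otherwise it would
be a center of a witness with a shorter base inside the old one. Such a vertex is then adjacent to
all of `A`, and two of them share the nonadjacent neighbors `s` and `b 1`, so they are adjacent.

Thus every vertex of `ST(G)` lies in a simplicial module inside `ST(G)`. These glue: if `u` and `v`
are adjacent in `ST(G)`, then a neighbor `x` of `u` outside the component is adjacent to `v`: either
`v` lies in the module of `u`, or `v` and `x` both lie in its neighborhood, which is a clique.
-/

namespace IntervalCompletion

section Components

variable {V : Type*} {G : SimpleGraph V} {S : Set V}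

theorem forall_mem_of_induce_preconnected (hS : (G.induce S).Preconnected) {P : V → Prop}
    (step : ∀ u ∈ S, ∀ v ∈ S, G.Adj u v → P u → P v) {u : V} (hu : u ∈ S) (hPu : P u) :
    ∀ v ∈ S, P v := by
  intro v hv
  have hr := SimpleGraph.reachable_iff_reflTransGen _ _ |>.1 (hS ⟨u, hu⟩ ⟨v, hv⟩)
  suffices h : ∀ w : S, Relation.ReflTransGen (G.induce S).Adj ⟨u, hu⟩ w → P w from h ⟨v, hv⟩ hr
  intro w hw
  induction hw with
  | refl => exact hPu
  | tail _ hvw ih => exact step _ (Subtype.prop _) _ (Subtype.prop _) hvw ih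

theorem induce_image_supp_connected (K : (G.induce S).ConnectedComponent) :
    (G.induce (Subtype.val '' K.supp)).Connected := by
  let f : K.toSimpleGraph →g G.induce (Subtype.val '' K.supp) :=
    { toFun := fun x => ⟨x.1.1, x.1, x.2, rfl⟩
      map_rel' := id }
  refine K.connected_toSimpleGraph.map f ?_
  rintro ⟨_, x, hx, rfl⟩
  exact ⟨⟨x, hx⟩, rfl⟩

theorem mem_image_supp_of_adj (K : (G.induce S).ConnectedComponent) {u v : V}
    (hu : u ∈ Subtype.val '' K.supp) (hv : v ∈ S) (huv : G.Adj u v) :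
    v ∈ Subtype.val '' K.supp := by
  obtain ⟨u, hu, rfl⟩ := hu
  exact ⟨⟨v, hv⟩, K.mem_supp_of_adj_mem_supp hu huv, rfl⟩

theorem subset_image_supp_of_induce_preconnected (K : (G.induce S).ConnectedComponent) {A : Set V}
    (hA : (G.induce A).Preconnected) (hAS : A ⊆ S) {u : V} (hu : u ∈ A)
    (huK : u ∈ Subtype.val '' K.supp) : A ⊆ Subtype.val '' K.supp :=
  forall_mem_of_induce_preconnected hA
    (fun _ _ _ hw hvw hv => mem_image_supp_of_adj K hv (hAS hw) hvw) hu huK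

theorem isModule_of_forall_adj {M : Set V}
    (h : ∀ u ∈ M, ∀ v ∈ M, ∀ x ∉ M, G.Adj u x → G.Adj v x) : IsModule G M :=
  fun u hu v hv x hx => ⟨h u hu v hv x hx, h v hv u hu x hx⟩

theorem isSimplicialModule_image_supp
    (hS : ∀ u ∈ S, ∃ A ⊆ S, u ∈ A ∧ IsSimplicialModule G A)
    (K : (G.induce S).ConnectedComponent) :
    IsSimplicialModule G (Subtype.val '' K.supp) := by
  set M := Subtype.val '' K.supp
  have hMS : M ⊆ S := Subtype.coe_image_subset S K.supp
  have hM : (G.induce M).Connected := induce_image_supp_connected K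
  have exists_module : ∀ u ∈ M, ∃ A ⊆ M, u ∈ A ∧ IsSimplicialModule G A := fun u hu =>
    let ⟨A, hAS, huA, hA⟩ := hS u (hMS hu)
    ⟨A, subset_image_supp_of_induce_preconnected K hA.2.1.preconnected hAS huA hu, huA, hA⟩
  have adj_of_adj : ∀ u ∈ M, ∀ v ∈ M, G.Adj u v → ∀ x ∉ M, G.Adj u x → G.Adj v x := by
    intro u hu v hv huv x hx hux
    obtain ⟨A, hAM, huA, hA, -, hA_clique⟩ := exists_module u hu
    have hxA : x ∉ A := fun h => hx (hAM h)
    by_cases hvA : v ∈ A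
    · exact (hA u huA v hvA x hxA).1 hux
    · exact hA_clique ⟨hvA, u, huA, huv⟩ ⟨hxA, u, huA, hux⟩ (ne_of_mem_of_not_mem hv hx)
  have module : IsModule G M := isModule_of_forall_adj fun u hu v hv x hx hux =>
    forall_mem_of_induce_preconnected hM.preconnected
      (fun v hv w hw hvw hvx => adj_of_adj v hv w hw hvw x hx hvx) hu hux v hv
  refine ⟨module, hM, ?_⟩
  rintro x ⟨hx, u, hu, hux⟩ y ⟨hy, v, hv, hvy⟩ hxy
  obtain ⟨A, hAM, huA, -, -, hA_clique⟩ := exists_module u hu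
  have huy : G.Adj u y := (module u hu v hv y hy).2 hvy
  exact hA_clique ⟨fun h => hx (hAM h), u, huA, hux⟩ ⟨fun h => hy (hAM h), u, huA, huy⟩ hxy

end Components

section InducedPaths

variable {V : Type*} {G : SimpleGraph V} {n : ℕ} {b : ℕ → V} {y : V}

/-- `b 0, b 1, ..., b n` is an induced path of `G`. Indexing by `ℕ` rather than `Fin (n + 1)` keeps
segments and reversals free of casts; the values of `b` beyond `n` are irrelevant. -/
structure IsInducedPath (G : SimpleGraph V) (n : ℕ) (b : ℕ → V) : Prop where
  injOn : Set.InjOn b (Set.Iic n)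
  adj_iff : ∀ i ≤ n, ∀ j ≤ n, G.Adj (b i) (b j) ↔ i + 1 = j ∨ j + 1 = i

namespace IsInducedPath

theorem adj_succ (hb : IsInducedPath G n b) {i : ℕ} (hi : i < n) : G.Adj (b i) (b (i + 1)) :=
  (hb.adj_iff i hi.le (i + 1) hi).2 (.inl rfl)

-- In a path on at least four vertices, distinct vertices have distinct neighborhoods: adjacency
-- alone gives injectivity.
theorem of_forall_lt (hn : 3 ≤ n) (h : ∀ j ≤ n, ∀ i < j, G.Adj (b i) (b j) ↔ i + 1 = j) :
    IsInducedPath G n b := by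
  have ne_of_lt : ∀ j ≤ n, ∀ i < j, b i ≠ b j := by
    rintro j hj i hij hbij
    obtain rfl | hi := Nat.eq_zero_or_pos i
    · have := h j hj 1
      have := h 1 (by omega) 0
      have := h 3 hn j
      have := h 3 hn 0
      grind [G.adj_comm, G.irrefl]
    · have := (h i (by omega) (i - 1) (by omega)).2 (by omega)
      have := (h j hj (i - 1) (by omega)).1 (hbij ▸ this)
      omega
  constructor
  · intro i hi j hj hij
    by_contra hne
    rcases lt_or_gt_of_ne hne with hlt | hlt
    exacts [ne_of_lt j hj i hlt hij, ne_of_lt i hi j hlt hij.symm]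
  · intro i hi j hj
    rcases lt_trichotomy i j with hij | rfl | hij
    · rw [h j hj i hij]
      omega
    · simp
    · rw [G.adj_comm, h i hi j hij]
      omega

theorem reverse (hb : IsInducedPath G n b) : IsInducedPath G n (fun i => b (n - i)) where
  injOn i hi j hj hij := by
    have := hb.injOn (Nat.sub_le n i) (Nat.sub_le n j) hij
    simp only [Set.mem_Iic] at hi hj
    omega
  adj_iff i hi j hj := by
    rw [hb.adj_iff _ (n.sub_le i) _ (n.sub_le j)]
    omega

theorem segment (hb : IsInducedPath G n b) {k m : ℕ} (hkm : k + m ≤ n) :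
    IsInducedPath G m (fun i => b (k + i)) where
  injOn i hi j hj hij := by
    simp only [Set.mem_Iic] at hi hj
    have := hb.injOn (Set.mem_Iic.2 (by omega)) (Set.mem_Iic.2 (by omega)) hij
    omega
  adj_iff i hi j hj := by
    rw [hb.adj_iff _ (by omega) _ (by omega)]
    omega

end IsInducedPath

theorem cycleGraph_adj_iff_val (i j : Fin (n + 2)) :
    (SimpleGraph.cycleGraph (n + 2)).Adj i j ↔ i.val + 1 = j ∨ j.val + 1 = i ∨
      (i.val = 0 ∧ j.val = n + 1) ∨ (j.val = 0 ∧ i.val = n + 1) := by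
  rw [SimpleGraph.cycleGraph_adj']
  rcases lt_trichotomy i j with hij | rfl | hij
  · rw [Fin.coe_sub_iff_lt.2 hij, Fin.sub_val_of_le hij.le]
    omega
  · simp only [sub_self, Fin.val_zero]
    omega
  · rw [Fin.coe_sub_iff_lt.2 hij, Fin.sub_val_of_le hij.le]
    omega

theorem IsInducedPath.hasHole (hb : IsInducedPath G n b) (hn : 2 ≤ n) (hy : ∀ i ≤ n, y ≠ b i)
    (hadj : ∀ i ≤ n, G.Adj y (b i) ↔ i = 0 ∨ i = n) : HasHole G := by
  let f : Fin (n + 2) → V := fun i => if i.val = n + 1 then y else b i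
  have f_injective : Function.Injective f := by
    intro i j hij
    have := @hb.injOn i
    grind
  have f_adj (i j : Fin (n + 2)) :
      G.Adj (f i) (f j) ↔ (SimpleGraph.cycleGraph (n + 2)).Adj i j := by
    rw [cycleGraph_adj_iff_val]
    have := hb.adj_iff i
    have := G.adj_comm y (b i)
    grind [G.irrefl]
  exact ⟨n + 2, by omega, ⟨⟨⟨f, f_injective⟩, f_adj _ _⟩⟩⟩

theorem IsInducedPath.adj_of_le_of_le (hb : IsInducedPath G n b) (hG : ¬ HasHole G)
    (hy : ∀ i ≤ n, y ≠ b i) {i m j : ℕ} (him : i ≤ m) (hmj : m ≤ j) (hj : j ≤ n)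
    (hyi : G.Adj y (b i)) (hyj : G.Adj y (b j)) : G.Adj y (b m) := by
  induction hlen : j - i using Nat.strong_induction_on generalizing i j with
  | _ len ih =>
  by_cases hk : ∃ k, i < k ∧ k < j ∧ G.Adj y (b k)
  · obtain ⟨k, hik, hkj, hyk⟩ := hk
    rcases le_total m k with hmk | hkm
    · exact ih (k - i) (by omega) him hmk (by omega) hyi hyk rfl
    · exact ih (j - k) (by omega) hkm hmj hj hyk hyj rfl
  · push Not at hk
    by_contra hym
    have : i ≠ m := by rintro rfl; exact hym hyi
    have : j ≠ m := by rintro rfl; exact hym hyj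
    refine hG ((hb.segment (k := i) (m := j - i) (by omega)).hasHole (by omega)
      (fun l hl => hy _ (by omega)) fun l hl => ⟨fun hyl => ?_, ?_⟩)
    · by_contra!
      exact hk (i + l) (by omega) (by omega) hyl
    · rintro (rfl | rfl)
      · exact hyi
      · rwa [Nat.add_sub_cancel' (by omega)]

theorem IsInducedPath.exists_adj_iff_le_and_le (hb : IsInducedPath G n b) (hG : ¬ HasHole G)
    (hy : ∀ i ≤ n, y ≠ b i) {k : ℕ} (hk : k ≤ n) (hyk : G.Adj y (b k)) :
    ∃ p q, ∀ i ≤ n, G.Adj y (b i) ↔ p ≤ i ∧ i ≤ q := by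
  classical
  have hex : ∃ i, G.Adj y (b i) := ⟨k, hyk⟩
  refine ⟨Nat.find hex, Nat.findGreatest (fun i => G.Adj y (b i)) n, fun i hi => ⟨fun hyi =>
    ⟨Nat.find_min' hex hyi, Nat.le_findGreatest hi hyi⟩, fun ⟨hpi, hiq⟩ => ?_⟩⟩
  exact hb.adj_of_le_of_le hG hy hpi hiq (Nat.findGreatest_le n) (Nat.find_spec hex)
    (Nat.findGreatest_spec (P := fun i => G.Adj y (b i)) hk hyk)

theorem isInducedPath_two {u v w : V} (huv : G.Adj u v) (hvw : G.Adj v w) (hne : u ≠ w)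
    (huw : ¬ G.Adj u w) : IsInducedPath G 2 (fun | 0 => u | 1 => v | _ => w) := by
  constructor
  · intro i hi j hj
    simp only [Set.mem_Iic] at hi hj
    interval_cases i <;> interval_cases j <;> grind [G.irrefl]
  · intro i hi j hj
    interval_cases i <;> interval_cases j <;> grind [G.adj_comm, G.irrefl]

theorem isClique_commonNeighbors (hG : ¬ HasHole G) {u v : V} (hne : u ≠ v)
    (huv : ¬ G.Adj u v) : G.IsClique (G.commonNeighbors u v) := by
  intro x hx y hy hxy
  simp only [SimpleGraph.mem_commonNeighbors] at hx hy
  have path := isInducedPath_two hx.1 hx.2.symm hne huv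
  refine (path.adj_of_le_of_le hG (i := 0) (m := 1) (j := 2) ?_ zero_le_one one_le_two le_rfl
    hy.1.symm hy.2.symm).symm
  intro i hi
  interval_cases i
  exacts [hy.1.ne', hxy.symm, hy.2.ne']

end InducedPaths

section ForbiddenSubgraphs

variable {V W : Type*} {G : SimpleGraph V} {H : SimpleGraph W} {b : ℕ → V} {u w : V}

theorem isIndContained_of_adj_iff (f : W → V) (hf : ∀ i j, G.Adj (f i) (f j) ↔ H.Adj i j)
    (twin_free : ∀ i j, (∀ k, H.Adj i k ↔ H.Adj j k) → i = j) : H ⊴ G :=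
  ⟨⟨⟨f, fun i j hij => twin_free i j fun k => by rw [← hf, ← hf, hij]⟩, hf _ _⟩⟩

theorem IsReduced.no_longClaw (hG : IsReduced G) (hb : IsInducedPath G 4 b)
    (hu : ∀ i ≤ 4, G.Adj u (b i) ↔ i = 2) (hw : ∀ i ≤ 4, ¬ G.Adj w (b i)) (hwu : G.Adj w u) :
    False := by
  refine hG.2 (.inl (isIndContained_of_adj_iff ![b 2, b 1, b 3, u, b 0, b 4, w] ?_ ?_))
  · simp [Fin.forall_fin_succ, longClaw, hb.adj_iff, hu, hw, hwu, hwu.symm, G.adj_comm (b _) u,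
      G.adj_comm (b _) w]
  · simp only [longClaw, SimpleGraph.fromEdgeSet_adj, Set.mem_insert_iff, Set.mem_singleton_iff]
    decide

theorem IsReduced.no_whippingTop (hG : IsReduced G) (hb : IsInducedPath G 4 b)
    (hu : ∀ i ≤ 4, G.Adj u (b i)) (hw : ∀ i ≤ 4, G.Adj w (b i) ↔ i = 2) (hwu : ¬ G.Adj w u) :
    False := by
  have huw : ¬ G.Adj u w := fun h => hwu h.symm
  refine hG.2 (.inr (.inl (isIndContained_of_adj_iff
    ![b 0, b 1, b 2, b 3, b 4, u, w] ?_ ?_)))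
  · simp [Fin.forall_fin_succ, whippingTop, hb.adj_iff, hu, hw, hwu, huw, G.adj_comm (b _) u,
      G.adj_comm (b _) w]
  · simp only [whippingTop, SimpleGraph.fromEdgeSet_adj, Set.mem_insert_iff,
      Set.mem_singleton_iff]
    decide

end ForbiddenSubgraphs

section AsteroidalWitnesses

variable {V : Type*} {G : SimpleGraph V} {d : ℕ} {s c₁ c₂ : V} {b : ℕ → V}

/-- The vertices `s`, `c₁`, `c₂` and `b 0, ..., b (d + 1)` induce in `G` a †-graph (if `c₁ = c₂`) or
a ‡-graph (if `c₁ ≠ c₂`) with `d` base vertices. The two families are described together because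
most arguments, and the reversal of the base, treat them alike. -/
structure IsAW (G : SimpleGraph V) (d : ℕ) (s c₁ c₂ : V) (b : ℕ → V) : Prop where
  path : IsInducedPath G (d + 1) b
  s_path : ∀ i ≤ d + 1, ¬ G.Adj s (b i)
  s_c₁ : G.Adj s c₁
  s_c₂ : G.Adj s c₂
  c₁_base : ∀ i, 1 ≤ i → i ≤ d → G.Adj c₁ (b i)
  c₂_base : ∀ i, 1 ≤ i → i ≤ d → G.Adj c₂ (b i)
  c₁_right : ¬ G.Adj c₁ (b (d + 1))
  c₂_left : ¬ G.Adj c₂ (b 0)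
  centers : c₁ = c₂ ∨ G.Adj c₁ c₂ ∧ G.Adj c₁ (b 0) ∧ G.Adj c₂ (b (d + 1))

/-- The base `b 1, ..., b d` of an asteroidal witness whose base path is `b 0, ..., b (d + 1)`. -/
def base (d : ℕ) (b : ℕ → V) : Set V :=
  b '' Set.Icc 1 d

theorem forall_mem_base {P : V → Prop} :
    (∀ z ∈ base d b, P z) ↔ ∀ i, 1 ≤ i → i ≤ d → P (b i) := by
  simp only [base, Set.forall_mem_image, Set.mem_Icc, and_imp]

theorem base_reverse : base d (fun i => b (d + 1 - i)) = base d b := by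
  ext z
  constructor <;> rintro ⟨i, ⟨hi, hid⟩, rfl⟩ <;>
    exact ⟨d + 1 - i, ⟨by omega, by omega⟩, congrArg b (by omega)⟩

theorem isAW_dagGraph : IsAW (dagGraph d) d .s .c .c (fun i => .b (Fin.ofNat (d + 2) i)) := by
  have val_eq (i : ℕ) (hi : i ≤ d + 1) : (Fin.ofNat (d + 2) i).val = i :=
    Nat.mod_eq_of_lt (by omega)
  constructor
  · constructor
    · intro i hi j hj
      grind
    · grind [dagGraph, SimpleGraph.fromRel_adj, DagVertex.rel]
  all_goals grind [dagGraph, SimpleGraph.fromRel_adj, DagVertex.rel]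

theorem isAW_ddagGraph :
    IsAW (ddagGraph d) d .s .c₁ .c₂ (fun i => .b (Fin.ofNat (d + 2) i)) := by
  have val_eq (i : ℕ) (hi : i ≤ d + 1) : (Fin.ofNat (d + 2) i).val = i :=
    Nat.mod_eq_of_lt (by omega)
  constructor
  · constructor
    · intro i hi j hj
      grind
    · grind [ddagGraph, SimpleGraph.fromRel_adj, DDagVertex.rel]
  all_goals grind [ddagGraph, SimpleGraph.fromRel_adj, DDagVertex.rel]

namespace IsAW

theorem of_center {y : V} (hb : IsInducedPath G (d + 1) b) (hs : ∀ i ≤ d + 1, ¬ G.Adj s (b i))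
    (hsy : G.Adj s y) (hy : ∀ i ≤ d + 1, G.Adj y (b i) ↔ 1 ≤ i ∧ i ≤ d) : IsAW G d s y y b where
  path := hb
  s_path := hs
  s_c₁ := hsy
  s_c₂ := hsy
  c₁_base i hi hid := (hy i (by omega)).2 ⟨hi, hid⟩
  c₂_base i hi hid := (hy i (by omega)).2 ⟨hi, hid⟩
  c₁_right h := by have := (hy _ le_rfl).1 h; omega
  c₂_left h := by have := (hy 0 (by omega)).1 h; omega
  centers := .inl rfl

theorem map {W : Type*} {H : SimpleGraph W} {s c₁ c₂ : W} {b : ℕ → W} (h : IsAW H d s c₁ c₂ b)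
    (f : H ↪g G) : IsAW G d (f s) (f c₁) (f c₂) (fun i => f (b i)) := by
  obtain ⟨⟨inj, adj⟩, h⟩ := h
  constructor
  · exact ⟨f.injective.comp_injOn inj, fun i hi j hj => f.map_adj_iff.trans (adj i hi j hj)⟩
  all_goals grind [f.map_adj_iff, f.injective]

theorem reverse (h : IsAW G d s c₁ c₂ b) : IsAW G d s c₂ c₁ (fun i => b (d + 1 - i)) where
  path := h.path.reverse
  s_path i _ := h.s_path _ (by omega)
  s_c₁ := h.s_c₂
  s_c₂ := h.s_c₁
  c₁_base i _ _ := h.c₂_base _ (by omega) (by omega)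
  c₂_base i _ _ := h.c₁_base _ (by omega) (by omega)
  c₁_right := by simpa using h.c₂_left
  c₂_left := h.c₁_right
  centers := by
    rcases h.centers with hc | ⟨hc, hl, hr⟩
    · exact .inl hc.symm
    · exact .inr ⟨hc.symm, hr, by simpa using hl⟩

theorem ne_path (h : IsAW G d s c₁ c₂ b) : ∀ i ≤ d + 1, s ≠ b i := by
  rintro i hi rfl
  obtain ⟨j, hj, hij⟩ : ∃ j ≤ d + 1, i + 1 = j ∨ j + 1 = i := by
    obtain rfl | hpos := Nat.eq_zero_or_pos i
    exacts [⟨1, by omega, by omega⟩, ⟨i - 1, by omega, by omega⟩]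
  exact h.s_path j hj ((h.path.adj_iff i hi j hj).2 hij)

theorem ne_path_of_adj (h : IsAW G d s c₁ c₂ b) {x : V} (hx : G.Adj s x) :
    ∀ i ≤ d + 1, x ≠ b i := by
  rintro i hi rfl
  exact h.s_path i hi hx

theorem exists_dagGraph_embedding (h : IsAW G d s c₁ c₁ b) :
    ∃ f : dagGraph d ↪g G, f .s = s := by
  let f : DagVertex d → V
    | .s => s
    | .c => c₁
    | .b i => b i
  have f_injective : Function.Injective f := by
    intro x y hxy
    have := h.path.injOn
    have := h.ne_path
    have := h.ne_path_of_adj h.s_c₁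
    have := h.s_c₁.ne
    cases x <;> cases y <;> grind [Set.InjOn]
  have f_adj (x y : DagVertex d) : G.Adj (f x) (f y) ↔ (dagGraph d).Adj x y := by
    rw [dagGraph, SimpleGraph.fromRel_adj]
    have := h.path.adj_iff
    cases x <;> cases y <;> grind [IsAW, DagVertex.rel, G.adj_comm, G.irrefl]
  exact ⟨⟨⟨f, f_injective⟩, f_adj _ _⟩, rfl⟩

theorem exists_ddagGraph_embedding (h : IsAW G d s c₁ c₂ b) (hne : c₁ ≠ c₂) :
    ∃ f : ddagGraph d ↪g G, f .s = s := by
  let f : DDagVertex d → V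
    | .s => s
    | .c₁ => c₁
    | .c₂ => c₂
    | .b i => b i
  have f_injective : Function.Injective f := by
    intro x y hxy
    have := h.path.injOn
    have := h.ne_path
    have := h.ne_path_of_adj h.s_c₁
    have := h.ne_path_of_adj h.s_c₂
    have := h.s_c₁.ne
    have := h.s_c₂.ne
    cases x <;> cases y <;> grind [Set.InjOn]
  have f_adj (x y : DDagVertex d) : G.Adj (f x) (f y) ↔ (ddagGraph d).Adj x y := by
    rw [ddagGraph, SimpleGraph.fromRel_adj]
    have := h.path.adj_iff
    cases x <;> cases y <;> grind [IsAW, DDagVertex.rel, G.adj_comm, G.irrefl]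
  exact ⟨⟨⟨f, f_injective⟩, f_adj _ _⟩, rfl⟩

theorem mem_shallowTerminals (h : IsAW G d s c₁ c₂ b) (hd : 3 < d) : s ∈ shallowTerminals G := by
  by_cases hc : c₁ = c₂
  · subst hc
    exact ⟨d, hd, .inl h.exists_dagGraph_embedding⟩
  · exact ⟨d, hd, .inr (h.exists_ddagGraph_embedding hc)⟩

theorem three_lt (h : IsAW G d s c₁ c₂ b) (hG : IsReduced G) (hd : 1 ≤ d)
    (hd' : c₁ = c₂ → 2 ≤ d) : 3 < d := by
  by_contra! hle
  by_cases hc : c₁ = c₂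
  · have := hd' hc
    subst hc
    obtain ⟨f, -⟩ := h.exists_dagGraph_embedding
    exact hG.2 (.inr (.inr (.inl ⟨d, this, hle, ⟨f⟩⟩)))
  · obtain ⟨f, -⟩ := h.exists_ddagGraph_embedding hc
    exact hG.2 (.inr (.inr (.inr ⟨d, hd, hle, ⟨f⟩⟩)))

end IsAW

theorem exists_isAW_of_mem_shallowTerminals (hs : s ∈ shallowTerminals G) :
    ∃ d, 3 < d ∧ ∃ c₁ c₂ b, IsAW G d s c₁ c₂ b := by
  obtain ⟨d, hd, ⟨f, rfl⟩ | ⟨f, rfl⟩⟩ := hs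
  exacts [⟨d, hd, _, _, _, isAW_dagGraph.map f⟩, ⟨d, hd, _, _, _, isAW_ddagGraph.map f⟩]

end AsteroidalWitnesses

section Reduced

variable {V : Type*} {G : SimpleGraph V} {d : ℕ} {s c₁ c₂ x y : V} {b : ℕ → V}

namespace IsAW

theorem adj_of_adj_path (h : IsAW G d s c₁ c₂ b) (hG : ¬ HasHole G) (hsx : G.Adj s x)
    (hsy : G.Adj s y) (hxy : x ≠ y) {i : ℕ} (hi : i ≤ d + 1) (hxi : G.Adj x (b i))
    (hyi : G.Adj y (b i)) : G.Adj x y :=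
  isClique_commonNeighbors hG (h.ne_path i hi) (h.s_path i hi) ⟨hsx, hxi.symm⟩ ⟨hsy, hyi.symm⟩ hxy

theorem adj_c₁_of_adj_right (h : IsAW G d s c₁ c₂ b) (hG : ¬ HasHole G) (hd : 1 ≤ d)
    (hsx : G.Adj s x) (hne : x ≠ c₁) (hx : G.Adj x (b (d + 1))) : G.Adj x c₁ := by
  have path : IsInducedPath G 3 (fun | 0 => s | 1 => c₁ | 2 => b d | _ => b (d + 1)) :=
    .of_forall_lt le_rfl fun j hj i hij => by
      have := h.path.adj_iff
      interval_cases j <;> interval_cases i <;> grind [IsAW]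
  refine path.adj_of_le_of_le hG (i := 0) (m := 1) (j := 3) (fun i hi => ?_) (by omega) (by omega)
    le_rfl hsx.symm hx
  have := h.ne_path_of_adj hsx
  interval_cases i <;> grind [hsx.ne]

theorem adj_c₁_or_adj_c₂ (h : IsAW G d s c₁ c₂ b) (hG : IsReduced G) (hd : 2 ≤ d)
    (hne : c₁ ≠ c₂) (hsx : G.Adj s x) (x_left : ¬ G.Adj x (b 0))
    (x_right : ¬ G.Adj x (b (d + 1))) : G.Adj x c₁ ∨ G.Adj x c₂ := by
  by_contra! hx
  have := h.path.adj_iff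
  have path : IsInducedPath G 3 (fun | 0 => b 0 | 1 => c₁ | 2 => c₂ | _ => b (d + 1)) :=
    .of_forall_lt le_rfl fun j hj i hij => by
      interval_cases j <;> interval_cases i <;> grind [IsAW, G.adj_comm]
  have net : IsAW G 2 x s s _ :=
    of_center path (fun i hi => by interval_cases i <;> grind) hsx.symm
      (fun i hi => by interval_cases i <;> grind [IsAW])
  have := net.three_lt hG
  omega

theorem isInducedPath_center (h : IsAW G d s c₁ c₁ b) (hd : 3 ≤ d) :
    IsInducedPath G 4 (fun | 0 => b 0 | 1 => b 1 | 2 => c₁ | 3 => b d | _ => b (d + 1)) :=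
  .of_forall_lt (by omega) fun j hj i hij => by
    have := h.path.adj_iff
    interval_cases j <;> interval_cases i <;> grind [IsAW, G.adj_comm]

theorem adj_center_of_base_free (h : IsAW G d s c₁ c₁ b) (hG : IsReduced G) (hd : 3 ≤ d)
    (hsx : G.Adj s x) (hne : x ≠ c₁) (hx : ∀ z ∈ base d b, ¬ G.Adj x z) : G.Adj x c₁ := by
  by_contra hx₁
  rw [forall_mem_base] at hx
  have := h.path.adj_iff
  have x_left : ¬ G.Adj x (b 0) := fun h' =>
    hx₁ (h.reverse.adj_c₁_of_adj_right hG.1 (by omega) hsx hne (by simpa using h'))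
  have x_right : ¬ G.Adj x (b (d + 1)) :=
    fun h' => hx₁ (h.adj_c₁_of_adj_right hG.1 (by omega) hsx hne h')
  have path := h.isInducedPath_center hd
  refine hG.no_longClaw path (u := s) (w := x) (fun i hi => ?_) (fun i hi => ?_) hsx.symm
  · interval_cases i <;> grind [IsAW]
  · interval_cases i <;> grind

theorem adj_c₁_of_base_free (h : IsAW G d s c₁ c₂ b) (hG : IsReduced G) (hd : 3 ≤ d)
    (hsx : G.Adj s x) (hx : ∀ z ∈ base d b, ¬ G.Adj x z) : G.Adj x c₁ := by
  have hx' := forall_mem_base.1 hx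
  have hne : x ≠ c₁ := by
    rintro rfl
    exact hx' 1 le_rfl (by omega) (h.c₁_base 1 le_rfl (by omega))
  by_cases hcc : c₁ = c₂
  · subst hcc
    exact h.adj_center_of_base_free hG hd hsx hne hx
  by_contra hx₁
  have := h.path.adj_iff
  have x_left : ¬ G.Adj x (b 0) := fun h' =>
    hx₁ (h.adj_of_adj_path hG.1 hsx h.s_c₁ hne (Nat.zero_le _) h' (h.centers.resolve_left hcc).2.1)
  have x_right : ¬ G.Adj x (b (d + 1)) :=
    fun h' => hx₁ (h.adj_c₁_of_adj_right hG.1 (by omega) hsx hne h')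
  have hx₂ : G.Adj x c₂ :=
    (h.adj_c₁_or_adj_c₂ hG (by omega) hcc hsx x_left x_right).resolve_left hx₁
  have path : IsInducedPath G 4 (fun | 0 => x | 1 => s | 2 => c₁ | 3 => b d | _ => b (d + 1)) :=
    .of_forall_lt (by omega) fun j hj i hij => by
      interval_cases j <;> interval_cases i <;> grind [IsAW, G.adj_comm]
  refine hG.no_whippingTop path (u := c₂) (w := b 0) (fun i hi => ?_) (fun i hi => ?_)
    fun h' => h.c₂_left h'.symm
  all_goals interval_cases i <;> grind [IsAW, G.adj_comm]

theorem not_adj_left_of_base_free (h : IsAW G d s c₁ c₂ b) (hG : ¬ HasHole G) (hd : 1 ≤ d)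
    (hsx : G.Adj s x) (hx : ∀ z ∈ base d b, ¬ G.Adj x z) (hx₂ : G.Adj x c₂) :
    ¬ G.Adj x (b 0) := by
  intro hx₀
  refine forall_mem_base.1 hx 1 le_rfl hd (isClique_commonNeighbors hG
    (h.ne_path_of_adj h.s_c₂ 0 (Nat.zero_le _)) h.c₂_left ⟨hx₂.symm, hx₀.symm⟩
    ⟨h.c₂_base 1 le_rfl hd, h.path.adj_succ (Nat.succ_pos d)⟩ (h.ne_path_of_adj hsx 1 (by omega)))

theorem replace_terminal (h : IsAW G d s c₁ c₂ b) (hG : IsReduced G) (hd : 3 ≤ d)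
    (hsx : G.Adj s x) (hx : ∀ z ∈ base d b, ¬ G.Adj x z) : IsAW G d x c₁ c₂ b := by
  have hx_reverse : ∀ z ∈ base d (fun i => b (d + 1 - i)), ¬ G.Adj x z := by rwa [base_reverse]
  have hx₁ := h.adj_c₁_of_base_free hG hd hsx hx
  have hx₂ := h.reverse.adj_c₁_of_base_free hG hd hsx hx_reverse
  have x_left := h.not_adj_left_of_base_free hG.1 (by omega) hsx hx hx₂
  have x_right := h.reverse.not_adj_left_of_base_free hG.1 (by omega) hsx hx_reverse hx₁
  have x_base := forall_mem_base.1 hx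
  refine { h with s_path := fun i hi => ?_, s_c₁ := hx₁, s_c₂ := hx₂ }
  obtain rfl | rfl | hi' : i = 0 ∨ i = d + 1 ∨ 1 ≤ i ∧ i ≤ d := by omega
  exacts [x_left, x_right, x_base i hi'.1 hi'.2]

theorem eq_or_adj_c₁ (h : IsAW G d s c₁ c₂ b) (hG : ¬ HasHole G) (hsy : G.Adj s y)
    {i : ℕ} (hi : 1 ≤ i) (hid : i ≤ d) (hyi : G.Adj y (b i)) : y = c₁ ∨ G.Adj y c₁ :=
  or_iff_not_imp_left.2 fun hne =>
    h.adj_of_adj_path hG hsy h.s_c₁ hne (by omega) hyi (h.c₁_base i hi hid)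

theorem adj_of_path_full (h : IsAW G d s c₁ c₂ b) (hG : IsReduced G) (hd : 3 ≤ d)
    (hy : ∀ i ≤ d + 1, G.Adj y (b i)) (hy₁ : G.Adj y c₁) (hy₂ : G.Adj y c₂) : G.Adj s y := by
  by_contra hsy
  have := h.path.adj_iff
  by_cases hcc : c₁ = c₂
  · subst hcc
    have path := h.isInducedPath_center hd
    refine hG.no_whippingTop path (u := y) (w := s) (fun i hi => ?_) (fun i hi => ?_) hsy
    all_goals interval_cases i <;> grind [IsAW]
  · have sun : IsAW G 1 s c₁ c₂ (fun | 0 => b 0 | 1 => y | _ => b (d + 1)) := by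
      constructor
      · exact isInducedPath_two (hy 0 (by omega)).symm (hy _ le_rfl) (by grind [IsAW]) (by grind)
      all_goals grind [IsAW, G.adj_comm]
    have := sun.three_lt hG le_rfl (absurd · hcc)
    omega

theorem adj_of_base_full_of_left (h : IsAW G d s c₁ c₂ b) (hG : IsReduced G) (hd : 3 ≤ d)
    (hx : IsAW G d x c₁ c₂ b) (hsx : G.Adj s x) (hsy : G.Adj s y) (hy : ∀ z ∈ base d b, G.Adj y z)
    (hy₁ : G.Adj y c₁) (hy₂ : G.Adj y c₂) (y_left : G.Adj y (b 0))
    (y_right : ¬ G.Adj y (b (d + 1))) : G.Adj x y := by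
  rw [forall_mem_base] at hy
  obtain rfl | ⟨-, -, hr⟩ := h.centers
  · by_contra hxy
    have := h.path.adj_iff
    have path : IsInducedPath G 3 (fun | 0 => b 0 | 1 => y | 2 => b d | _ => b (d + 1)) :=
      .of_forall_lt le_rfl fun j hj i hij => by
        interval_cases j <;> interval_cases i <;> grind [G.adj_comm]
    have net : IsAW G 2 x c₁ c₁ _ :=
      of_center path (fun i hi => by interval_cases i <;> grind [IsAW]) hx.s_c₁
        (fun i hi => by interval_cases i <;> grind [IsAW, G.adj_comm])
    have := net.three_lt hG
    omega
  · have h' : IsAW G d s y c₂ b :=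
      { h with
        s_c₁ := hsy
        c₁_base := hy
        c₁_right := y_right
        centers := .inr ⟨hy₂, y_left, hr⟩ }
    exact h'.adj_c₁_of_base_free hG hd hsx
      (forall_mem_base.2 fun i _ _ => hx.s_path i (by omega))

theorem adj_of_base_full (h : IsAW G d s c₁ c₂ b) (hG : IsReduced G) (hd : 3 ≤ d)
    (hx : IsAW G d x c₁ c₂ b) (hsx : G.Adj s x) (hsy : G.Adj s y)
    (hy : ∀ z ∈ base d b, G.Adj y z) : G.Adj x y := by
  have hy' := forall_mem_base.1 hy
  obtain rfl | hy₁ := h.eq_or_adj_c₁ hG.1 hsy le_rfl (by omega) (hy' 1 le_rfl (by omega))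
  · exact hx.s_c₁
  obtain rfl | hy₂ := h.reverse.eq_or_adj_c₁ hG.1 hsy le_rfl (by omega)
    (hy' d (by omega) le_rfl)
  · exact hx.s_c₂
  by_cases y_left : G.Adj y (b 0) <;> by_cases y_right : G.Adj y (b (d + 1))
  · refine (hx.adj_of_path_full hG hd (fun i hi => ?_) hy₁ hy₂)
    obtain rfl | rfl | hi' : i = 0 ∨ i = d + 1 ∨ 1 ≤ i ∧ i ≤ d := by omega
    exacts [y_left, y_right, hy' i hi'.1 hi'.2]
  · exact h.adj_of_base_full_of_left hG hd hx hsx hsy hy hy₁ hy₂ y_left y_right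
  · refine h.reverse.adj_of_base_full_of_left hG hd hx.reverse hsx hsy ?_ hy₂ hy₁ y_right ?_
    · rwa [base_reverse]
    · simpa using y_left
  · have h' : IsAW G d s y y b := of_center h.path h.s_path hsy fun i hi =>
      ⟨fun hyi => by grind, fun hi' => hy' i hi'.1 hi'.2⟩
    exact h'.adj_c₁_of_base_free hG hd hsx
      (forall_mem_base.2 fun i _ _ => hx.s_path i (by omega))

theorem not_forall_adj_iff_eq (h : IsAW G d s c₁ c₂ b) (hG : IsReduced G) (hd : 3 ≤ d)
    (hsy : G.Adj s y) {p : ℕ} (hp : 1 ≤ p) (hpd : p < d) :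
    ¬ ∀ i ≤ d + 1, G.Adj y (b i) ↔ i = p := by
  intro hy
  have := h.path.adj_iff
  obtain rfl | hp' := hp.eq_or_lt
  · obtain rfl | hy₂ := h.reverse.eq_or_adj_c₁ hG.1 hsy (i := d) (by omega) le_rfl
      (by simpa using (hy 1 (by omega)).2 rfl)
    · have := (hy 2 (by omega)).1 (h.c₂_base 2 (by omega) (by omega))
      omega
    have path : IsInducedPath G 4 (fun | 0 => s | 1 => y | 2 => b 1 | 3 => b 2 | _ => b 3) :=
      .of_forall_lt (by omega) fun j hj i hij => by
        interval_cases j <;> interval_cases i <;> grind [IsAW, G.adj_comm]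
    refine hG.no_whippingTop path (u := c₂) (w := b 0) (fun i hi => ?_) (fun i hi => ?_)
      fun h' => h.c₂_left h'.symm
    all_goals interval_cases i <;> grind [IsAW, G.adj_comm]
  · refine hG.no_longClaw (h.path.segment (k := p - 2) (m := 4) (by omega)) (u := y) (w := s)
      (fun i hi => ?_) (fun i hi => h.s_path _ (by omega)) hsy
    rw [hy _ (by omega)]
    omega

theorem exists_shorter_of_adj_iff (h : IsAW G d s c₁ c₂ b) (hG : IsReduced G) (hd : 3 ≤ d)
    (hsy : G.Adj s y) {p q : ℕ} (hq : 1 ≤ q) (hpq : p ≤ q) (hqd : q < d)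
    (hy : ∀ i ≤ d + 1, G.Adj y (b i) ↔ p ≤ i ∧ i ≤ q) :
    ∃ d', 3 < d' ∧ d' < d ∧ ∃ c₁' c₂' b', IsAW G d' s c₁' c₂' b' ∧ base d' b' ⊆ base d b := by
  obtain rfl | hp := Nat.eq_zero_or_pos p
  · have hne : y ≠ c₂ := by
      rintro rfl
      exact h.c₂_left ((hy 0 (by omega)).2 (by omega))
    have hy₂ : G.Adj y c₂ := h.adj_of_adj_path hG.1 hsy h.s_c₂ hne (i := q) (by omega)
      ((hy q (by omega)).2 (by omega)) (h.c₂_base q hq (by omega))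
    have h' : IsAW G q s y c₂ b :=
      { h with
        path := by simpa using h.path.segment (k := 0) (m := q + 1) (by omega)
        s_path := fun i hi => h.s_path i (by omega)
        s_c₁ := hsy
        c₁_base := by grind
        c₂_base := by grind [IsAW]
        c₁_right := by grind
        centers := by grind [IsAW] }
    refine ⟨q, h'.three_lt hG hq fun hc => absurd hc hne, by omega, y, c₂, b, h', ?_⟩
    exact Set.image_mono (Set.Icc_subset_Icc_right (by omega))
  · obtain rfl | hpq := hpq.eq_or_lt
    · refine absurd (fun i hi => ?_) (h.not_forall_adj_iff_eq hG hd hsy hq hqd)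
      rw [hy i hi]
      omega
    have path := h.path.segment (k := p - 1) (m := q - p + 1 + 1) (by omega)
    have h' : IsAW G (q - p + 1) s y y _ :=
      of_center path (fun i hi => h.s_path _ (by omega)) hsy fun i hi => by
        rw [hy _ (by omega)]
        omega
    refine ⟨q - p + 1, h'.three_lt hG (by omega) fun _ => by omega, by omega, y, y, _, h', ?_⟩
    rintro _ ⟨i, ⟨hi, hid⟩, rfl⟩
    exact ⟨p - 1 + i, ⟨by omega, by omega⟩, rfl⟩

theorem exists_shorter_of_lt (h : IsAW G d s c₁ c₂ b) (hG : IsReduced G) (hd : 3 ≤ d)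
    (hsy : G.Adj s y) {k m : ℕ} (hk : 1 ≤ k) (hkm : k < m) (hm : m ≤ d) (hyk : G.Adj y (b k))
    (hym : ¬ G.Adj y (b m)) :
    ∃ d', 3 < d' ∧ d' < d ∧ ∃ c₁' c₂' b', IsAW G d' s c₁' c₂' b' ∧ base d' b' ⊆ base d b := by
  obtain ⟨p, q, hy⟩ := h.path.exists_adj_iff_le_and_le hG.1 (h.ne_path_of_adj hsy) (k := k)
    (by omega) hyk
  have hk' := (hy k (by omega)).1 hyk
  rw [hy m (by omega)] at hym
  exact h.exists_shorter_of_adj_iff hG hd hsy (by omega) (by omega) (by omega) hy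

theorem exists_shorter (h : IsAW G d s c₁ c₂ b) (hG : IsReduced G) (hd : 3 ≤ d)
    (hsy : G.Adj s y) (hy : ∃ z ∈ base d b, G.Adj y z) (hy' : ∃ z ∈ base d b, ¬ G.Adj y z) :
    ∃ d', 3 < d' ∧ d' < d ∧ ∃ c₁' c₂' b', IsAW G d' s c₁' c₂' b' ∧ base d' b' ⊆ base d b := by
  obtain ⟨_, ⟨k, ⟨hk, hkd⟩, rfl⟩, hyk⟩ := hy
  obtain ⟨_, ⟨m, ⟨hm, hmd⟩, rfl⟩, hym⟩ := hy'
  obtain hkm | rfl | hmk := lt_trichotomy k m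
  · exact h.exists_shorter_of_lt hG hd hsy hk hkm hmd hyk hym
  · exact absurd hyk hym
  · rw [← base_reverse (b := b)]
    refine h.reverse.exists_shorter_of_lt hG hd hsy (k := d + 1 - k) (m := d + 1 - m) (by omega)
      (by omega) (by omega) ?_ ?_
    · rwa [Nat.sub_sub_self (by omega)]
    · rwa [Nat.sub_sub_self (by omega)]

section ReplaceTerminal

variable {M : Set V}

theorem of_mem_of_induce_preconnected (h : IsAW G d s c₁ c₂ b) (hG : IsReduced G) (hd : 3 ≤ d)
    (hM : (G.induce M).Preconnected) (hfree : ∀ v ∈ M, ∀ z ∈ base d b, ¬ G.Adj v z)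
    (hs : s ∈ M) : ∀ u ∈ M, IsAW G d u c₁ c₂ b :=
  forall_mem_of_induce_preconnected hM
    (fun _ _ w hw hvw hv => hv.replace_terminal hG hd hvw (hfree w hw)) hs h

theorem adj_of_mem_of_base_full (h : IsAW G d s c₁ c₂ b) (hG : IsReduced G) (hd : 3 ≤ d)
    (hM : (G.induce M).Preconnected) (hfree : ∀ v ∈ M, ∀ z ∈ base d b, ¬ G.Adj v z)
    (hs : s ∈ M) (hsy : G.Adj s y) (hy : ∀ z ∈ base d b, G.Adj y z) : ∀ u ∈ M, G.Adj u y :=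
  have hM_aw := h.of_mem_of_induce_preconnected hG hd hM hfree hs
  forall_mem_of_induce_preconnected hM (fun v hv w hw hvw hvy =>
    (hM_aw v hv).adj_of_base_full hG hd (hM_aw w hw) hvw hvy hy) hs hsy

theorem base_full_of_minimal (h : IsAW G d s c₁ c₂ b) (hG : IsReduced G) (hd : 3 ≤ d)
    (hmin : ∀ d' < d, ¬ (3 < d' ∧ ∃ c₁' c₂' b', IsAW G d' s c₁' c₂' b'))
    (hM : (G.induce M).Preconnected) (hfree : ∀ v ∈ M, ∀ z ∈ base d b, ¬ G.Adj v z)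
    (hs : s ∈ M) {u : V} (hu : u ∈ M) (hux : G.Adj u x) (hx : ∃ z ∈ base d b, G.Adj x z) :
    ∀ z ∈ base d b, G.Adj x z := by
  by_contra! hx'
  obtain ⟨d', hd', hlt, c₁', c₂', b', h', hbase⟩ :=
    (h.of_mem_of_induce_preconnected hG hd hM hfree hs u hu).exists_shorter hG hd hux hx hx'
  have hs' := h'.of_mem_of_induce_preconnected hG hd'.le hM
    (fun v hv z hz => hfree v hv z (hbase hz)) hu s hs
  exact hmin d' hlt ⟨hd', c₁', c₂', b', hs'⟩

end ReplaceTerminal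

end IsAW

theorem exists_isSimplicialModule_of_mem_shallowTerminals (hG : IsReduced G) :
    ∀ s ∈ shallowTerminals G, ∃ A ⊆ shallowTerminals G, s ∈ A ∧ IsSimplicialModule G A := by
  classical
  intro s hs
  have exists_aw := exists_isAW_of_mem_shallowTerminals hs
  obtain ⟨hd, c₁, c₂, b, h⟩ := Nat.find_spec exists_aw
  have hmin : ∀ d' < Nat.find exists_aw, _ := fun _ => Nat.find_min exists_aw
  set d := Nat.find exists_aw
  let F : Set V := {v | ∀ z ∈ base d b, ¬ G.Adj v z}
  have hsF : s ∈ F := forall_mem_base.2 fun i _ _ => h.s_path i (by omega)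
  let K := (G.induce F).connectedComponentMk ⟨s, hsF⟩
  let A : Set V := Subtype.val '' K.supp
  have hsA : s ∈ A := ⟨⟨s, hsF⟩, rfl, rfl⟩
  have hA : (G.induce A).Connected := induce_image_supp_connected K
  have hfree : ∀ v ∈ A, v ∈ F := Subtype.coe_image_subset F K.supp
  have base_full : ∀ u ∈ A, ∀ x ∉ A, G.Adj u x → ∀ z ∈ base d b, G.Adj x z := by
    intro u hu x hx hux
    refine h.base_full_of_minimal hG hd.le hmin hA.preconnected hfree hsA hu hux ?_
    by_contra! hxF
    exact hx (mem_image_supp_of_adj K hu hxF hux)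
  have aw : ∀ u ∈ A, IsAW G d u c₁ c₂ b :=
    h.of_mem_of_induce_preconnected hG hd.le hA.preconnected hfree hsA
  have adj_of_adj : ∀ u ∈ A, ∀ v ∈ A, ∀ x ∉ A, G.Adj u x → G.Adj v x := fun u hu v hv x hx hux =>
    (aw u hu).adj_of_mem_of_base_full hG hd.le hA.preconnected hfree hu hux
      (base_full u hu x hx hux) v hv
  refine ⟨A, fun u hu => (aw u hu).mem_shallowTerminals hd, hsA, isModule_of_forall_adj adj_of_adj,
    hA, ?_⟩
  rintro x ⟨hx, u, hu, hux⟩ y ⟨hy, v, hv, hvy⟩ hxy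
  have hbase : b 1 ∈ base d b := ⟨1, ⟨le_rfl, by omega⟩, rfl⟩
  exact h.adj_of_adj_path hG.1 (adj_of_adj u hu s hsA x hx hux) (adj_of_adj v hv s hsA y hy hvy)
    hxy (by omega) (base_full u hu x hx hux _ hbase) (base_full v hv y hy hvy _ hbase)

end Reduced

end IntervalCompletion

theorem mainTheorem5 {V : Type*} (G : SimpleGraph V) (hG : IntervalCompletion.IsReduced G)
    (K : (G.induce (IntervalCompletion.shallowTerminals G)).ConnectedComponent) :
    IntervalCompletion.IsSimplicialModule G (Subtype.val '' K.supp) :=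
  IntervalCompletion.isSimplicialModule_image_supp
    (IntervalCompletion.exists_isSimplicialModule_of_mem_shallowTerminals hG) K
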